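/- All graphs are finite, simple, undirected and unweighted. For a connected graph $G$ with at least two vertices and Laplacian $L=D-A$, the resistance distance is $r_G(s,t)=(e_s-e_t)^{T}L^{\dagger}(e_s-e_t)$, where $L^\dagger$ is the Moore–Penrose pseudo-inverse, and the condition number is $\kappa(G)=2/\mu_2$, where $\mu_2$ is the smallest non-zero eigenvalue of the normalized Laplacian $I-D^{-1/2}AD^{-1/2}$. In the adjacency-list model a graph on the vertex set $\{0,\dots,n-1\}$ is given by an arbitrarily ordered list of neighbours for each vertex and is accessible only through degree queries (return $d_v$), neighbour queries (return the $i$-th neighbour of $v$, or report that there is none) and jump queries (return a uniformly random vertex). Approximating $r_G(s,t)$ in this model with absolute error $\epsilon\le 0.01$ and success probability at least $0.6$ requires $\Omega(\kappa)$ queries. Precisely: there are constants $c>0$ and $K_0$ such that for every $K\ge K_0$ there are an $n$, two distinct vertices $s,t$ and a connected $n$-vertex graph $G$ (with ordered adjacency lists) with $cK\le\kappa(G)\le K$ for which the following holds. Let $0<\epsilon\le 0.01$ and let $\mathcal{A}$ be any randomized query algorithm (which may depend on $n,s,t,\epsilon,K$) that, on every connected graph $H$ on the same vertex set with $\kappa(H)\le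 K$ and for every ordering of its adjacency lists, outputs with probability at least $0.6$ a number $\hat r$ with $|\hat r-r_H(s,t)|\le\epsilon$. Then the expected number of queries that $\mathcal{A}$ makes on $G$ is at least $cK\ge c\,\kappa(G)$; in particular its worst-case number of queries on $G$ is at least $c\,\kappa(G)$. -/

import Mathlib

open MeasureTheory
open scoped ENNReal Matrix

/-! ## Graphs given by adjacency lists, resistance distance, condition number -/

/-- A simple undirected unweighted graph on the vertex set `Fin n`, presented by adjacency lists:
`nbrs v` lists the neighbours of `v`, without repetition, in an arbitrary order. -/
structure AdjList (n : ℕ) where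
  nbrs : Fin n → List (Fin n)
  nodup : ∀ v, (nbrs v).Nodup
  irrefl : ∀ v, v ∉ nbrs v
  symm : ∀ u v, v ∈ nbrs u → u ∈ nbrs v

namespace AdjList

variable {n : ℕ}

/-- The underlying simple graph. -/
def graph (G : AdjList n) : SimpleGraph (Fin n) where
  Adj u v := v ∈ G.nbrs u
  symm := ⟨fun u v h => G.symm u v h⟩
  loopless := ⟨fun v h => G.irrefl v h⟩

instance (G : AdjList n) : DecidableRel G.graph.Adj :=
  fun u v => inferInstanceAs (Decidable (v ∈ G.nbrs u))

/-- The Laplacian matrix `L = D - A`. -/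
def lap (G : AdjList n) : Matrix (Fin n) (Fin n) ℝ := G.graph.lapMatrix ℝ

theorem lap_isHermitian (G : AdjList n) : G.lap.IsHermitian :=
  G.graph.isHermitian_lapMatrix ℝ

/-- The pseudo-inverse `L† = ∑ (1/λᵢ) uᵢ uᵢᵀ`, the sum running over the nonzero eigenvalues
of `L` (the terms with `λᵢ = 0` vanish because `0⁻¹ = 0`). -/
noncomputable def lapPinv (G : AdjList n) : Matrix (Fin n) (Fin n) ℝ :=
  ∑ i, (G.lap_isHermitian.eigenvalues i)⁻¹ •
    Matrix.vecMulVec (G.lap_isHermitian.eigenvectorBasis i) (G.lap_isHermitian.eigenvectorBasis i)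

/-- The resistance distance `r(s,t) = (eₛ - eₜ)ᵀ L† (eₛ - eₜ)`. -/
noncomputable def resistance (G : AdjList n) (s t : Fin n) : ℝ :=
  (Pi.single s 1 - Pi.single t 1) ⬝ᵥ (G.lapPinv *ᵥ (Pi.single s 1 - Pi.single t 1))

/-- The normalized Laplacian `I - D^{-1/2} A D^{-1/2}`. -/
noncomputable def normLap (G : AdjList n) : Matrix (Fin n) (Fin n) ℝ :=
  1 - Matrix.diagonal (fun v => (√(G.graph.degree v : ℝ))⁻¹) * G.graph.adjMatrix ℝ *
    Matrix.diagonal (fun v => (√(G.graph.degree v : ℝ))⁻¹)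

/-- The condition number `κ = 2 / μ₂`, with `μ₂` the smallest nonzero eigenvalue of the
normalized Laplacian (the spectrum is a finite set of nonnegative reals, so that the infimum is a
minimum whenever the graph has an edge). -/
noncomputable def kappa (G : AdjList n) : ℝ :=
  2 / sInf {μ : ℝ | μ ∈ spectrum ℝ G.normLap ∧ μ ≠ 0}

end AdjList

/-! ## The adjacency-list query model -/

/-- The three types of queries. -/
inductive Query (n : ℕ) where
  /-- ask for the degree of `v` -/
  | degree (v : Fin n)
  /-- ask for the `i`-th entry (counted from `0`) of the adjacency list of `v` -/
  | neighbor (v : Fin n) (i : ℕ)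
  /-- ask for a uniformly random vertex -/
  | jump

/-- Answers to queries. -/
inductive Answer (n : ℕ) where
  | number (d : ℕ)
  | vertex (v : Fin n)
  /-- the answer to a neighbour query beyond the end of the list -/
  | nothing

instance (n : ℕ) : MeasurableSpace (Query n) := ⊤

/-- The answer of the oracle for `G`; `j` is the random vertex to be returned if the query is a
jump query. -/
def AdjList.answer {n : ℕ} (G : AdjList n) (j : Fin n) : Query n → Answer n
  | .degree v => .number (G.nbrs v).length
  | .neighbor v i => ((G.nbrs v)[i]?).elim .nothing .vertex
  | .jump => .vertex j

/-- A deterministic query algorithm: from the answers received so far (in order) it determines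
either the next query or the real number that it outputs when it stops. -/
abbrev DetAlg (n : ℕ) : Type := List (Answer n) → Query n ⊕ ℝ

namespace DetAlg

variable {n : ℕ}

/-- The answers that `D` has received after `k` steps on `G`, where `J k` is the random vertex
drawn at step `k`. Once `D` has stopped, the transcript does not change any more. -/
def transcript (D : DetAlg n) (G : AdjList n) (J : ℕ → Fin n) : ℕ → List (Answer n)
  | 0 => []
  | k + 1 =>
    match D (transcript D G J k) with
    | .inl q => transcript D G J k ++ [G.answer (J k) q]
    | .inr _ => transcript D G J k

/-- `D` stops on `G` and outputs `r`. -/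
def Outputs (D : DetAlg n) (G : AdjList n) (J : ℕ → Fin n) (r : ℝ) : Prop :=
  ∃ k, D (D.transcript G J k) = .inr r

/-- The total number of queries (infinite if `D` does not stop). -/
noncomputable def numQueries (D : DetAlg n) (G : AdjList n) (J : ℕ → Fin n) : ℝ≥0∞ :=
  ⨆ k, ((D.transcript G J k).length : ℝ≥0∞)

end DetAlg

/-- A randomized query algorithm on graphs with vertex set `Fin n`: a deterministic algorithm
that depends measurably on the outcome `ω` of its internal coins, which live on an arbitrary
probability space. -/
structure RandAlg (n : ℕ) where
  Ω : Type
  [mΩ : MeasurableSpace Ω]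
  μ : Measure Ω
  [isProb : IsProbabilityMeasure μ]
  alg : Ω → DetAlg n
  measurable_alg : ∀ h : List (Answer n), Measurable fun ω => alg ω h

attribute [instance] RandAlg.mΩ RandAlg.isProb

namespace RandAlg

variable {n : ℕ} [NeZero n]

/-- The joint law of the internal coins and of the random vertices returned by jump queries, which
are independent, uniformly distributed, and independent of the coins. -/
noncomputable def law (A : RandAlg n) : Measure (A.Ω × (ℕ → Fin n)) :=
  A.μ.prod (Measure.infinitePi fun _ : ℕ => (PMF.uniformOfFintype (Fin n)).toMeasure)

/-- The probability that `A`, run on `G`, stops with an output within `ε` of `r(s,t)`. -/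
noncomputable def successProb (A : RandAlg n) (G : AdjList n) (s t : Fin n) (ε : ℝ) : ℝ≥0∞ :=
  A.law {p | ∃ r : ℝ, (A.alg p.1).Outputs G p.2 r ∧ |r - G.resistance s t| ≤ ε}

/-- The expected number of queries that `A` makes on `G`. -/
noncomputable def expectedQueries (A : RandAlg n) (G : AdjList n) : ℝ≥0∞ :=
  ∫⁻ p, (A.alg p.1).numQueries G p.2 ∂A.law

end RandAlg

/-! ## Query lower bound for families of inputs that differ in disjoint sets of queries -/

/-! Let `G` be two copies of a complete graph on `2k+1` vertices joined by a bridge `st` between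
their hubs, so that `r(s,t) = 1`. For `k²` pairs `p, q` of non-hub vertices let `H` arise from `G`
by crossing the edge `pq`: its two copies are replaced by the two edges joining `p` in one copy to
`q` in the other. This creates a path of length three from `s` to `t` parallel to the bridge, so
`r(s,t) ≤ 3/4`.

All these graphs are two-lifts of one base graph. With adjacency lists ordered as in the base,
crossing changes no degree and only the entries for `pq`, so a query separates `G` from at most one
`H`, and a run with `l` queries from at most `l` of them (`card_transcript_ne_le`). With shared
coins an algorithm is correct on both `G` and a given `H` with probability at least `0.6 + 0.6 - 1 =
0.2`; its outputs then differ, so the runs differ. Summing over `H` gives at least `0.2 k²` expected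
queries (`expectedQueries_ge`).

It remains to see that `κ` is of order `k²`. Paths through the hubs bound squared potential
differences by `9` times the energy, whence `κ ≤ 9 vol` for every lift (`kappa_le`). The function
`±1/2` on the two copies of `G` gives `κ ≥ vol / 2` (`le_kappa`). -/

instance (n : ℕ) : Countable (Answer n) := by
  have : Function.Injective (fun a : Answer n => match a with
      | .number d => (Sum.inl d : ℕ ⊕ Option (Fin n))
      | .vertex v => .inr (some v)
      | .nothing => .inr none) := by
    intro a b h
    cases a <;> cases b <;> simp_all
  exact this.countable

namespace DetAlg

variable {n : ℕ}

theorem transcript_succ_inl {D : DetAlg n} {G : AdjList n} {J : ℕ → Fin n} {k : ℕ} {q : Query n}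
    (h : D (D.transcript G J k) = .inl q) :
    D.transcript G J (k + 1) = D.transcript G J k ++ [G.answer (J k) q] := by
  simp only [transcript, h]

theorem transcript_succ_inr {D : DetAlg n} {G : AdjList n} {J : ℕ → Fin n} {k : ℕ} {r : ℝ}
    (h : D (D.transcript G J k) = .inr r) :
    D.transcript G J (k + 1) = D.transcript G J k := by
  simp only [transcript, h]

theorem Outputs.eventually {D : DetAlg n} {G : AdjList n} {J : ℕ → Fin n} {r : ℝ}
    (h : D.Outputs G J r) : ∀ᶠ k in Filter.atTop, D (D.transcript G J k) = .inr r := by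
  obtain ⟨k, hk⟩ := h
  refine Filter.eventually_atTop.2 ⟨k, fun j hj => ?_⟩
  induction j, hj using Nat.le_induction with
  | base => exact hk
  | succ j _ ih => rw [transcript_succ_inr ih, ih]

open Classical in
/-- If every query is answered differently from `G` by at most one `H i`, then a run on `G` of
length `l` can be told apart from the runs on at most `l` of the `H i`. -/
theorem card_transcript_ne_le {ι : Type*} [Fintype ι] (D : DetAlg n) (G : AdjList n)
    (H : ι → AdjList n) (J : ℕ → Fin n)
    (hH : ∀ q i i' j, (H i).answer j q ≠ G.answer j q → (H i').answer j q ≠ G.answer j q → i = i')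
    (k : ℕ) :
    (Finset.univ.filter fun i => D.transcript (H i) J k ≠ D.transcript G J k).card ≤
      (D.transcript G J k).length := by
  induction k with
  | zero => simp [transcript]
  | succ k ih =>
    rcases hq : D (D.transcript G J k) with q | r
    · have hsub : (Finset.univ.filter fun i =>
            D.transcript (H i) J (k + 1) ≠ D.transcript G J (k + 1)) ⊆
          (Finset.univ.filter fun i => D.transcript (H i) J k ≠ D.transcript G J k) ∪
          (Finset.univ.filter fun i => (H i).answer (J k) q ≠ G.answer (J k) q) := by
        intro i
        simp only [Finset.mem_union, Finset.mem_filter, Finset.mem_univ, true_and]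
        contrapose!
        rintro ⟨h1, h2⟩
        rw [transcript_succ_inl hq, transcript_succ_inl (by rw [h1, hq]), h1, h2]
      have hone : (Finset.univ.filter fun i =>
          (H i).answer (J k) q ≠ G.answer (J k) q).card ≤ 1 := by
        rw [Finset.card_le_one]
        intro i hi i' hi'
        exact hH q i i' (J k) (Finset.mem_filter.1 hi).2 (Finset.mem_filter.1 hi').2
      calc _ ≤ _ := Finset.card_le_card hsub
        _ ≤ _ := Finset.card_union_le _ _
        _ ≤ _ := Nat.add_le_add ih hone
        _ = _ := by rw [transcript_succ_inl hq]; simp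
    · rw [transcript_succ_inr hq]
      refine (Finset.card_le_card fun i => ?_).trans ih
      simp only [Finset.mem_filter, Finset.mem_univ, true_and]
      contrapose!
      intro h1
      rw [transcript_succ_inr (by rw [h1, hq]), h1]

open Classical in
-- A transcript determines the output, so once two runs have stopped with different outputs their
-- transcripts differ. Finiteness of `I` gives one time `k` that serves all its members.
theorem card_outputs_ne_le_numQueries {ι : Type*} [Fintype ι] (D : DetAlg n) (G : AdjList n)
    (H : ι → AdjList n) (J : ℕ → Fin n)
    (hH : ∀ q i i' j, (H i).answer j q ≠ G.answer j q → (H i').answer j q ≠ G.answer j q → i = i')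
    (I : Finset ι) (hI : ∀ i ∈ I, ∃ r r', D.Outputs G J r ∧ D.Outputs (H i) J r' ∧ r ≠ r') :
    (I.card : ℝ≥0∞) ≤ D.numQueries G J := by
  have hev : ∀ᶠ k in Filter.atTop, ∀ i ∈ I, D.transcript (H i) J k ≠ D.transcript G J k := by
    rw [Filter.eventually_all_finset]
    intro i hi
    obtain ⟨r, r', h, h', hne⟩ := hI i hi
    filter_upwards [h.eventually, h'.eventually] with k hk hk' he
    rw [he, hk] at hk'
    exact hne (Sum.inr_injective hk')
  obtain ⟨k, hk⟩ := hev.exists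
  refine le_trans ?_ (le_iSup (fun k => ((D.transcript G J k).length : ℝ≥0∞)) k)
  exact_mod_cast (Finset.card_le_card fun i hi => Finset.mem_filter.2
    ⟨Finset.mem_univ i, hk i hi⟩).trans (card_transcript_ne_le D G H J hH k)

end DetAlg

/-! ### Measurability of runs and averaging over the coins -/

namespace RandAlg

variable {n : ℕ}

/-- There are only countably many transcripts, so the event splits into a countable union over the
preceding transcript and the vertex drawn, on each piece of which only the next move matters. -/
theorem measurableSet_transcript_eq (A : RandAlg n) (G : AdjList n) (k : ℕ)
    (h : List (Answer n)) :
    MeasurableSet {p : A.Ω × (ℕ → Fin n) | (A.alg p.1).transcript G p.2 k = h} := by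
  induction k generalizing h with
  | zero => simp [DetAlg.transcript]
  | succ k ih =>
    have hset : {p : A.Ω × (ℕ → Fin n) | (A.alg p.1).transcript G p.2 (k + 1) = h} =
        ⋃ h' : List (Answer n), {p | (A.alg p.1).transcript G p.2 k = h'} ∩
          ⋃ j : Fin n, {p | p.2 k = j} ∩ {p | A.alg p.1 h' ∈
            (Sum.inl '' {q | h' ++ [G.answer j q] = h} ∪ Sum.inr '' {_r | h' = h} :
              Set (Query n ⊕ ℝ))} := by
      ext p
      simp only [Set.mem_iUnion, Set.mem_inter_iff, Set.mem_ofPred_eq, exists_eq_left',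
        Set.mem_union, Set.mem_image]
      rcases hq : A.alg p.1 ((A.alg p.1).transcript G p.2 k) with q | r
      · rw [DetAlg.transcript_succ_inl hq]; simp
      · rw [DetAlg.transcript_succ_inr hq]; simp
    rw [hset]
    refine MeasurableSet.iUnion fun h' => (ih h').inter (MeasurableSet.iUnion fun j =>
      MeasurableSet.inter ?_ ?_)
    · have hk : Measurable fun p : A.Ω × (ℕ → Fin n) => p.2 k := by fun_prop
      exact hk (measurableSet_singleton j)
    · refine ((A.measurable_alg h').comp measurable_fst) (MeasurableSet.union ?_ ?_)
      · exact MeasurableSet.inl_image MeasurableSpace.measurableSet_top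
      · exact MeasurableSet.inr_image (MeasurableSet.const _)

theorem measurableSet_outputs (A : RandAlg n) (G : AdjList n) {S : Set ℝ} (hS : MeasurableSet S) :
    MeasurableSet {p : A.Ω × (ℕ → Fin n) | ∃ r, (A.alg p.1).Outputs G p.2 r ∧ r ∈ S} := by
  have hset : {p : A.Ω × (ℕ → Fin n) | ∃ r, (A.alg p.1).Outputs G p.2 r ∧ r ∈ S} =
      ⋃ (k : ℕ) (h : List (Answer n)), {p | (A.alg p.1).transcript G p.2 k = h} ∩
        {p | A.alg p.1 h ∈ (Sum.inr '' S : Set (Query n ⊕ ℝ))} := by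
    ext p
    simp only [Set.mem_iUnion, Set.mem_inter_iff, Set.mem_ofPred_eq, exists_eq_left',
      Set.mem_image, DetAlg.Outputs]
    constructor
    · rintro ⟨r, ⟨k, hk⟩, hr⟩
      exact ⟨k, r, hr, hk.symm⟩
    · rintro ⟨k, r, hr, hk⟩
      exact ⟨r, ⟨k, hk.symm⟩, hr⟩
  rw [hset]
  exact MeasurableSet.iUnion fun k => MeasurableSet.iUnion fun h =>
    (A.measurableSet_transcript_eq G k h).inter
      (((A.measurable_alg h).comp measurable_fst) (MeasurableSet.inr_image hS))

instance [NeZero n] (A : RandAlg n) : IsProbabilityMeasure A.law := by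
  unfold law; infer_instance

theorem expectedQueries_ge [NeZero n] {ι : Type*} [Fintype ι] (A : RandAlg n) (G : AdjList n)
    (H : ι → AdjList n) (s t : Fin n) (ε : ℝ)
    (hH : ∀ q i i' j, (H i).answer j q ≠ G.answer j q → (H i').answer j q ≠ G.answer j q → i = i')
    (hr : ∀ i, 2 * ε < |G.resistance s t - (H i).resistance s t|)
    (hG : ENNReal.ofReal 0.6 ≤ A.successProb G s t ε)
    (hHs : ∀ i, ENNReal.ofReal 0.6 ≤ A.successProb (H i) s t ε) :
    ENNReal.ofReal (0.2 * Fintype.card ι) ≤ A.expectedQueries G := by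
  classical
  let S : AdjList n → Set (A.Ω × (ℕ → Fin n)) := fun F =>
    {p | ∃ r : ℝ, (A.alg p.1).Outputs F p.2 r ∧ |r - F.resistance s t| ≤ ε}
  have hS : ∀ F, MeasurableSet (S F) := fun F =>
    A.measurableSet_outputs F (S := {r | |r - F.resistance s t| ≤ ε})
      (measurableSet_le (by fun_prop) (by fun_prop))
  -- Inclusion–exclusion, both runs using the same coins and the same jump vertices.
  have hinter : ∀ i, ENNReal.ofReal 0.2 ≤ A.law (S G ∩ S (H i)) := by
    intro i
    have h1 := measure_union_add_inter (μ := A.law) (S G) (hS (H i))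
    have h2 : A.law (S G ∪ S (H i)) ≤ 1 := prob_le_one
    have h3 : ENNReal.ofReal 0.6 + ENNReal.ofReal 0.6 ≤ 1 + A.law (S G ∩ S (H i)) := by
      refine (add_le_add hG (hHs i)).trans ?_
      refine h1.symm.le.trans ?_
      gcongr
    have h4 : (1 : ℝ≥0∞) + ENNReal.ofReal 0.2 = ENNReal.ofReal 0.6 + ENNReal.ofReal 0.6 := by
      rw [← ENNReal.ofReal_one, ← ENNReal.ofReal_add (by norm_num) (by norm_num),
        ← ENNReal.ofReal_add (by norm_num) (by norm_num)]
      norm_num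
    rw [← h4] at h3
    exact (ENNReal.add_le_add_iff_left ENNReal.one_ne_top).1 h3
  have hpt : ∀ p : A.Ω × (ℕ → Fin n),
      ∑ i, (S G ∩ S (H i)).indicator (fun _ => (1 : ℝ≥0∞)) p ≤ (A.alg p.1).numQueries G p.2 := by
    intro p
    have := DetAlg.card_outputs_ne_le_numQueries (A.alg p.1) G H p.2 hH
      (Finset.univ.filter fun i => p ∈ S G ∩ S (H i)) (fun i hi => by
        obtain ⟨⟨r, h1, h2⟩, ⟨r', h1', h2'⟩⟩ := (Finset.mem_filter.1 hi).2
        refine ⟨r, r', h1, h1', ?_⟩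
        rintro rfl
        have := hr i
        rw [abs_le] at h2 h2'
        rcases le_abs'.1 this.le with h | h <;> rcases lt_abs.1 this with h | h <;> linarith)
    refine le_trans (le_of_eq ?_) this
    simp [Set.indicator_apply]
  calc ENNReal.ofReal (0.2 * Fintype.card ι) = ∑ _i : ι, ENNReal.ofReal 0.2 := by
        rw [Finset.sum_const, Finset.card_univ, nsmul_eq_mul, mul_comm,
          ENNReal.ofReal_mul (by positivity), ENNReal.ofReal_natCast]
    _ ≤ ∑ i, A.law (S G ∩ S (H i)) := Finset.sum_le_sum fun i _ => hinter i
    _ = ∑ i, ∫⁻ p, (S G ∩ S (H i)).indicator (fun _ => (1 : ℝ≥0∞)) p ∂A.law := by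
        refine Finset.sum_congr rfl fun i _ => ?_
        exact (lintegral_indicator_one ((hS G).inter (hS (H i)))).symm
    _ = ∫⁻ p, ∑ i, (S G ∩ S (H i)).indicator (fun _ => (1 : ℝ≥0∞)) p ∂A.law := by
        rw [lintegral_finsetSum]
        exact fun i _ => measurable_const.indicator ((hS G).inter (hS (H i)))
    _ ≤ A.expectedQueries G := lintegral_mono hpt

end RandAlg

/-! ## Spectral expansions of real symmetric matrices -/

namespace Matrix.IsHermitian

theorem dotProduct_mulVec_comm {m : Type*} [Fintype m] {A : Matrix m m ℝ}
    (hA : A.IsHermitian) (x y : m → ℝ) : x ⬝ᵥ (A *ᵥ y) = (A *ᵥ x) ⬝ᵥ y := by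
  have hT : Aᵀ = A := by simpa [IsHermitian, conjTranspose_eq_transpose_of_trivial] using hA
  rw [dotProduct_mulVec, ← mulVec_transpose, hT]

variable {m : Type*} [Fintype m] [DecidableEq m] {A : Matrix m m ℝ} (hA : A.IsHermitian)

theorem sum_eigenvectorBasis_dotProduct_mul (x y : m → ℝ) :
    ∑ i, (⇑(hA.eigenvectorBasis i) ⬝ᵥ x) * (⇑(hA.eigenvectorBasis i) ⬝ᵥ y) = x ⬝ᵥ y := by
  have h := hA.eigenvectorBasis.sum_inner_mul_inner (WithLp.toLp 2 x) (WithLp.toLp 2 y)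
  simp only [EuclideanSpace.inner_eq_star_dotProduct, star_trivial] at h
  rw [dotProduct_comm x y, ← h]
  exact Finset.sum_congr rfl fun i _ => by rw [dotProduct_comm y]

theorem eigenvectorBasis_dotProduct (i j : m) :
    ⇑(hA.eigenvectorBasis i) ⬝ᵥ ⇑(hA.eigenvectorBasis j) = if i = j then 1 else 0 := by
  have h := orthonormal_iff_ite.1 hA.eigenvectorBasis.orthonormal j i
  simp only [EuclideanSpace.inner_eq_star_dotProduct, star_trivial] at h
  rw [h]
  simp only [eq_comm]

theorem eigenvectorBasis_dotProduct_mulVec (i : m) (x : m → ℝ) :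
    ⇑(hA.eigenvectorBasis i) ⬝ᵥ (A *ᵥ x) =
      hA.eigenvalues i * (⇑(hA.eigenvectorBasis i) ⬝ᵥ x) := by
  rw [hA.dotProduct_mulVec_comm, hA.mulVec_eigenvectorBasis, smul_dotProduct, smul_eq_mul]

theorem dotProduct_mulVec_self_eq_sum (x : m → ℝ) :
    x ⬝ᵥ (A *ᵥ x) = ∑ i, hA.eigenvalues i * (⇑(hA.eigenvectorBasis i) ⬝ᵥ x) ^ 2 := by
  rw [← hA.sum_eigenvectorBasis_dotProduct_mul]
  refine Finset.sum_congr rfl fun i _ => ?_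
  rw [eigenvectorBasis_dotProduct_mulVec]
  ring

end Matrix.IsHermitian

/-! ## Energy and resistance -/

namespace AdjList

variable {n : ℕ} (G : AdjList n)

/-- The Dirichlet energy `∑ (f u - f v)²`, summed over the edges `uv`. -/
noncomputable def energy (f : Fin n → ℝ) : ℝ :=
  (∑ i, ∑ j, if G.graph.Adj i j then (f i - f j) ^ 2 else 0) / 2

theorem dotProduct_lap_mulVec (f : Fin n → ℝ) : f ⬝ᵥ (G.lap *ᵥ f) = G.energy f := by
  rw [energy, ← SimpleGraph.lapMatrix_toLinearMap₂', Matrix.toLinearMap₂'_apply', lap]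

theorem energy_nonneg (f : Fin n → ℝ) : 0 ≤ G.energy f := by
  unfold energy
  positivity

theorem sum_sum_adj_le_energy (f : Fin n → ℝ) (s : Finset (Fin n))
    (t : Fin n → Finset (Fin n)) (h : ∀ i ∈ s, ∀ j ∈ t i, G.graph.Adj i j) :
    (∑ i ∈ s, ∑ j ∈ t i, (f i - f j) ^ 2) / 2 ≤ G.energy f := by
  unfold energy
  gcongr
  have hnn : ∀ i j, 0 ≤ if G.graph.Adj i j then (f i - f j) ^ 2 else 0 := fun i j => by positivity
  calc _ ≤ ∑ i ∈ s, ∑ j, (if G.graph.Adj i j then (f i - f j) ^ 2 else 0) := by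
        refine Finset.sum_le_sum fun i hi => ?_
        rw [Finset.sum_congr rfl fun j hj => (if_pos (h i hi j hj)).symm]
        exact Finset.sum_le_sum_of_subset_of_nonneg (Finset.subset_univ _) fun j _ _ => hnn i j
    _ ≤ _ := Finset.sum_le_sum_of_subset_of_nonneg (Finset.subset_univ _) fun i _ _ =>
        Finset.sum_nonneg fun j _ => hnn i j

theorem sq_sub_le_energy (f : Fin n → ℝ) {u v : Fin n} (h : G.graph.Adj u v) :
    (f u - f v) ^ 2 ≤ G.energy f := by
  have hne : u ≠ v := h.ne
  have := G.sum_sum_adj_le_energy f {u, v} (fun i => if i = u then {v} else {u}) (by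
    simp [hne.symm, h, h.symm])
  rw [Finset.sum_pair hne] at this
  simp only [if_true, if_neg hne.symm, Finset.sum_singleton] at this
  nlinarith

theorem cycle_le_energy (f : Fin n → ℝ) {a b c d : Fin n} (hab : G.graph.Adj a b)
    (hbc : G.graph.Adj b c) (hcd : G.graph.Adj c d) (hda : G.graph.Adj d a)
    (hac : a ≠ c) (hbd : b ≠ d) :
    (f a - f b) ^ 2 + (f b - f c) ^ 2 + (f c - f d) ^ 2 + (f d - f a) ^ 2 ≤ G.energy f := by
  have h1 := hab.ne
  have h2 := hbc.ne
  have h3 := hcd.ne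
  have h4 := hda.ne
  have := G.sum_sum_adj_le_energy f {a, b, c, d}
    (fun i => if i = a ∨ i = c then {b, d} else {a, c}) (by
      simp [h1.symm, h2, h3.symm, h4, hab, hab.symm, hbc, hbc.symm, hcd, hcd.symm, hda, hda.symm])
  rw [Finset.sum_insert (by simp [h1, hac, h4.symm]), Finset.sum_insert (by simp [h2, hbd]),
    Finset.sum_pair h3] at this
  simp only [true_or, or_true, if_true, h1.symm, h2, h3.symm, h4, or_self, if_false,
    Finset.sum_pair hac, Finset.sum_pair hbd] at this
  nlinarith

theorem resistance_eq_sum (s t : Fin n) :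
    G.resistance s t = ∑ i, (G.lap_isHermitian.eigenvalues i)⁻¹ *
      (⇑(G.lap_isHermitian.eigenvectorBasis i) ⬝ᵥ (Pi.single s 1 - Pi.single t 1)) ^ 2 := by
  rw [resistance, lapPinv, Matrix.sum_mulVec, dotProduct_sum]
  refine Finset.sum_congr rfl fun i _ => ?_
  rw [Matrix.smul_mulVec, Matrix.vecMulVec_mulVec, dotProduct_smul, op_smul_eq_smul,
    dotProduct_smul, dotProduct_comm (Pi.single s 1 - Pi.single t 1), smul_eq_mul, smul_eq_mul]
  ring

/-- In the eigenbasis both sides are `∑ λᵢ aᵢ²`, with `aᵢ` the coefficients of `f`; zero eigenvalues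
contribute nothing to either. -/
theorem resistance_eq_of_lap_mulVec {s t : Fin n} {f : Fin n → ℝ}
    (hf : G.lap *ᵥ f = Pi.single s 1 - Pi.single t 1) : G.resistance s t = f s - f t := by
  rw [resistance_eq_sum, ← hf]
  simp only [Matrix.IsHermitian.eigenvectorBasis_dotProduct_mulVec]
  have h : f ⬝ᵥ (G.lap *ᵥ f) = f s - f t := by
    rw [hf, dotProduct_sub, dotProduct_single, dotProduct_single, mul_one, mul_one]
  rw [← h, G.lap_isHermitian.dotProduct_mulVec_self_eq_sum]
  refine Finset.sum_congr rfl fun i _ => ?_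
  by_cases h0 : G.lap_isHermitian.eigenvalues i = 0
  · simp [h0]
  · field_simp

/-- The potential of the unit current flow from `s` to `t`: its energy and its drop from `s` to `t`
are both equal to the resistance. -/
theorem exists_potential (s t : Fin n) :
    ∃ f : Fin n → ℝ, f s - f t = G.resistance s t ∧ G.energy f = G.resistance s t := by
  let x : Fin n → ℝ := Pi.single s 1 - Pi.single t 1
  refine ⟨G.lapPinv *ᵥ x, ?_, ?_⟩
  · rw [resistance, sub_dotProduct, single_dotProduct, single_dotProduct, one_mul, one_mul]
  · rw [← dotProduct_lap_mulVec, G.lap_isHermitian.dotProduct_mulVec_self_eq_sum,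
      resistance_eq_sum]
    refine Finset.sum_congr rfl fun i _ => ?_
    have h : ⇑(G.lap_isHermitian.eigenvectorBasis i) ⬝ᵥ (G.lapPinv *ᵥ x) =
        (G.lap_isHermitian.eigenvalues i)⁻¹ *
          (⇑(G.lap_isHermitian.eigenvectorBasis i) ⬝ᵥ x) := by
      rw [lapPinv, Matrix.sum_mulVec, dotProduct_sum, Finset.sum_eq_single i]
      · rw [Matrix.smul_mulVec, Matrix.vecMulVec_mulVec, dotProduct_smul, op_smul_eq_smul,
          dotProduct_smul, Matrix.IsHermitian.eigenvectorBasis_dotProduct]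
        simp
      · intro j _ hj
        rw [Matrix.smul_mulVec, Matrix.vecMulVec_mulVec, dotProduct_smul, op_smul_eq_smul,
          dotProduct_smul, Matrix.IsHermitian.eigenvectorBasis_dotProduct]
        simp [hj.symm]
      · simp
    rw [h]
    by_cases h0 : G.lap_isHermitian.eigenvalues i = 0
    · simp [h0]
    · field_simp
      rfl

/-- The edge `ad` in parallel with a path of length three. -/
theorem resistance_le_of_cycle {a b c d : Fin n} (hab : G.graph.Adj a b)
    (hbc : G.graph.Adj b c) (hcd : G.graph.Adj c d) (hda : G.graph.Adj d a)
    (hac : a ≠ c) (hbd : b ≠ d) : G.resistance a d ≤ 3 / 4 := by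
  obtain ⟨f, h1, h2⟩ := G.exists_potential a d
  have h := G.cycle_le_energy f hab hbc hcd hda hac hbd
  rw [h2, ← h1] at h
  rw [← h1]
  -- For `r = f a - f d`, the edge has energy `r²` and the path at least `r² / 3` by Cauchy–Schwarz,
  -- so `4 r² / 3 ≤ r`.
  by_contra! hlt
  nlinarith [sq_nonneg ((f a - f b) - (f b - f c)), sq_nonneg ((f b - f c) - (f c - f d)),
    sq_nonneg ((f a - f b) - (f c - f d))]

/-! ## Bounds for the condition number -/

theorem normLap_isHermitian : G.normLap.IsHermitian := by
  unfold normLap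
  refine Matrix.isHermitian_one.sub ?_
  rw [Matrix.IsHermitian, Matrix.conjTranspose_mul, Matrix.conjTranspose_mul,
    (Matrix.isHermitian_diagonal _).eq, (G.graph.isHermitian_adjMatrix (R := ℝ)).eq,
    Matrix.mul_assoc]

/-- The sum of all degrees. -/
noncomputable def vol : ℝ := ∑ v, (G.graph.degree v : ℝ)

variable {G}

/-- The substitution `D^{1/2} f` turns Rayleigh quotients of the normalized Laplacian into energy
divided by the degree-weighted square norm. -/
theorem normLap_mulVec_sqrt_mul (hd : ∀ v, 0 < G.graph.degree v) (f : Fin n → ℝ) (v : Fin n) :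
    (G.normLap *ᵥ fun u => √(G.graph.degree u : ℝ) * f u) v =
      (√(G.graph.degree v : ℝ))⁻¹ * (G.lap *ᵥ f) v := by
  have hs : ∀ u, √(G.graph.degree u : ℝ) ≠ 0 := fun u =>
    (Real.sqrt_pos.2 (by exact_mod_cast hd u)).ne'
  have hsq : √(G.graph.degree v : ℝ) * √(G.graph.degree v : ℝ) = G.graph.degree v :=
    Real.mul_self_sqrt (Nat.cast_nonneg _)
  have hmul : (Matrix.diagonal (fun v => (√(G.graph.degree v : ℝ))⁻¹) *ᵥ
      fun u => √(G.graph.degree u : ℝ) * f u) = f := by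
    ext u
    rw [Matrix.mulVec_diagonal, ← mul_assoc, inv_mul_cancel₀ (hs u), one_mul]
  rw [normLap, Matrix.sub_mulVec, Matrix.one_mulVec, ← Matrix.mulVec_mulVec,
    ← Matrix.mulVec_mulVec, hmul, Pi.sub_apply, Matrix.mulVec_diagonal, lap,
    SimpleGraph.lapMatrix_mulVec_apply, SimpleGraph.adjMatrix_mulVec_apply, mul_sub,
    ← mul_assoc]
  congr 2
  rw [eq_inv_mul_iff_mul_eq₀ (hs v), hsq]

theorem dotProduct_normLap_mulVec (hd : ∀ v, 0 < G.graph.degree v) (f g : Fin n → ℝ) :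
    (fun u => √(G.graph.degree u : ℝ) * g u) ⬝ᵥ
      (G.normLap *ᵥ fun u => √(G.graph.degree u : ℝ) * f u) = g ⬝ᵥ (G.lap *ᵥ f) := by
  refine Finset.sum_congr rfl fun v _ => ?_
  have hs : √(G.graph.degree v : ℝ) ≠ 0 := (Real.sqrt_pos.2 (by exact_mod_cast hd v)).ne'
  rw [normLap_mulVec_sqrt_mul hd]
  field_simp

theorem one_dotProduct_lap_mulVec (f : Fin n → ℝ) : (fun _ => (1 : ℝ)) ⬝ᵥ (G.lap *ᵥ f) = 0 := by
  rw [G.lap_isHermitian.dotProduct_mulVec_comm, lap]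
  have := G.graph.lapMatrix_mulVec_const_eq_zero (R := ℝ)
  simp [this]

/-- An eigenvector of the normalized Laplacian, rescaled to a function `f` on the vertices. -/
theorem exists_harmonic (hd : ∀ v, 0 < G.graph.degree v) (i : Fin n) :
    ∃ f : Fin n → ℝ,
      ⇑(G.normLap_isHermitian.eigenvectorBasis i) = (fun v => √(G.graph.degree v : ℝ) * f v) ∧
      G.energy f = G.normLap_isHermitian.eigenvalues i ∧
      (∑ v, (G.graph.degree v : ℝ) * f v ^ 2) = 1 ∧
      (G.normLap_isHermitian.eigenvalues i ≠ 0 → ∑ v, (G.graph.degree v : ℝ) * f v = 0) := by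
  have hs : ∀ u, √(G.graph.degree u : ℝ) ≠ 0 := fun u =>
    (Real.sqrt_pos.2 (by exact_mod_cast hd u)).ne'
  have hsq : ∀ v, √(G.graph.degree v : ℝ) * √(G.graph.degree v : ℝ) = G.graph.degree v := fun v =>
    Real.mul_self_sqrt (Nat.cast_nonneg _)
  set u : Fin n → ℝ := ⇑(G.normLap_isHermitian.eigenvectorBasis i) with hu
  let f : Fin n → ℝ := fun v => (√(G.graph.degree v : ℝ))⁻¹ * u v
  have huf : u = fun v => √(G.graph.degree v : ℝ) * f v := by
    ext v
    simp only [f]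
    rw [← mul_assoc, mul_inv_cancel₀ (hs v), one_mul]
  have huu : u ⬝ᵥ u = 1 := by
    rw [hu, Matrix.IsHermitian.eigenvectorBasis_dotProduct, if_pos rfl]
  have hNu : G.normLap *ᵥ u = G.normLap_isHermitian.eigenvalues i • u :=
    G.normLap_isHermitian.mulVec_eigenvectorBasis i
  refine ⟨f, huf, ?_, ?_, fun hne => ?_⟩
  · rw [← dotProduct_lap_mulVec, ← dotProduct_normLap_mulVec hd, ← huf, hNu, dotProduct_smul, huu,
      smul_eq_mul, mul_one]
  · rw [← huu, dotProduct]
    refine Finset.sum_congr rfl fun v _ => ?_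
    rw [huf]
    linear_combination -(f v) ^ 2 * hsq v
  · have h := dotProduct_normLap_mulVec hd f fun _ => 1
    rw [one_dotProduct_lap_mulVec, ← huf, hNu, dotProduct_smul, smul_eq_mul] at h
    rw [← (mul_eq_zero.1 h).resolve_left hne, dotProduct]
    refine Finset.sum_congr rfl fun v _ => ?_
    rw [huf]
    linear_combination -(f v) * hsq v

/-- The variance as an average of squared differences over pairs; the cross term vanishes because
the weighted mean is zero. -/
theorem two_mul_sum_mul_sq_le {ι : Type*} [Fintype ι] {d f : ι → ℝ} {C : ℝ} (hd : ∀ v, 0 ≤ d v)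
    (h0 : ∑ v, d v * f v = 0) (hC : ∀ u v, (f u - f v) ^ 2 ≤ C) :
    2 * (∑ v, d v) * (∑ v, d v * f v ^ 2) ≤ C * (∑ v, d v) ^ 2 := by
  have h1 : ∑ u, ∑ v, d u * d v * (f u - f v) ^ 2 = 2 * (∑ v, d v) * (∑ v, d v * f v ^ 2) := by
    have : ∀ u v, d u * d v * (f u - f v) ^ 2 =
        (d u * f u ^ 2) * d v - 2 * ((d u * f u) * (d v * f v)) + d u * (d v * f v ^ 2) :=
      fun u v => by ring
    simp only [this, Finset.sum_add_distrib, Finset.sum_sub_distrib, ← Finset.mul_sum,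
      ← Finset.sum_mul, h0]
    ring
  have h2 : ∑ u, ∑ v, d u * d v * (f u - f v) ^ 2 ≤ ∑ u, ∑ v, d u * d v * C :=
    Finset.sum_le_sum fun u _ => Finset.sum_le_sum fun v _ =>
      mul_le_mul_of_nonneg_left (hC u v) (mul_nonneg (hd u) (hd v))
  rw [h1] at h2
  refine h2.trans (le_of_eq ?_)
  simp only [← Finset.sum_mul, ← Finset.mul_sum]
  ring

theorem two_div_le_of_mem_spectrum (hd : ∀ v, 0 < G.graph.degree v) {C : ℝ} (hC0 : 0 < C)
    (hC : ∀ (f : Fin n → ℝ) u v, (f u - f v) ^ 2 ≤ C * G.energy f) {μ : ℝ}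
    (hμ : μ ∈ spectrum ℝ G.normLap) (h0 : μ ≠ 0) : 0 < G.vol ∧ 2 / (C * G.vol) ≤ μ := by
  rw [G.normLap_isHermitian.spectrum_real_eq_range_eigenvalues] at hμ
  obtain ⟨i, rfl⟩ := hμ
  obtain ⟨f, -, hE, h1, hz⟩ := exists_harmonic hd i
  have hv : 0 < G.vol := Finset.sum_pos (fun v _ => by exact_mod_cast hd v) ⟨i, Finset.mem_univ i⟩
  have h := two_mul_sum_mul_sq_le (fun v => Nat.cast_nonneg _) (hz h0) (hC f)
  rw [h1, hE] at h
  change 2 * G.vol * 1 ≤ _ * G.vol ^ 2 at h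
  refine ⟨hv, ?_⟩
  rw [div_le_iff₀ (by positivity)]
  nlinarith

theorem kappa_le (hd : ∀ v, 0 < G.graph.degree v) {C : ℝ} (hC0 : 0 < C)
    (hC : ∀ (f : Fin n → ℝ) u v, (f u - f v) ^ 2 ≤ C * G.energy f) : G.kappa ≤ C * G.vol := by
  have hv : 0 ≤ G.vol := Finset.sum_nonneg fun v _ => Nat.cast_nonneg _
  unfold kappa
  rcases Set.eq_empty_or_nonempty {μ : ℝ | μ ∈ spectrum ℝ G.normLap ∧ μ ≠ 0} with he | hne
  · rw [he, Real.sInf_empty, div_zero]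
    positivity
  · have h := le_csInf hne fun μ hμ => (two_div_le_of_mem_spectrum hd hC0 hC hμ.1 hμ.2).2
    obtain ⟨μ, hμ⟩ := hne
    have hv := (two_div_le_of_mem_spectrum hd hC0 hC hμ.1 hμ.2).1
    have hp : 0 < 2 / (C * G.vol) := by positivity
    rw [div_le_iff₀ (hp.trans_le h)]
    rw [div_le_iff₀ (by positivity)] at h
    linarith

/-- The Rayleigh principle with test function `f`. The bound `hC` forces the kernel to come from
constants, to which `f` is orthogonal, and keeps the infimum of the nonzero spectrum positive. -/
theorem le_kappa (hd : ∀ v, 0 < G.graph.degree v) {C : ℝ} (hC0 : 0 < C)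
    (hC : ∀ (f : Fin n → ℝ) u v, (f u - f v) ^ 2 ≤ C * G.energy f) {f : Fin n → ℝ}
    (h0 : ∑ v, (G.graph.degree v : ℝ) * f v = 0)
    (hpos : 0 < ∑ v, (G.graph.degree v : ℝ) * f v ^ 2) {R : ℝ}
    (hR : G.energy f ≤ R * ∑ v, (G.graph.degree v : ℝ) * f v ^ 2) : 2 / R ≤ G.kappa := by
  have hsq : ∀ v, √(G.graph.degree v : ℝ) * √(G.graph.degree v : ℝ) = G.graph.degree v := fun v =>
    Real.mul_self_sqrt (Nat.cast_nonneg _)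
  set g : Fin n → ℝ := fun v => √(G.graph.degree v : ℝ) * f v with hg
  have hgg : g ⬝ᵥ g = ∑ v, (G.graph.degree v : ℝ) * f v ^ 2 := by
    refine Finset.sum_congr rfl fun v _ => ?_
    rw [hg]
    linear_combination (f v) ^ 2 * hsq v
  have hNg : g ⬝ᵥ (G.normLap *ᵥ g) = G.energy f := by
    rw [dotProduct_normLap_mulVec hd, dotProduct_lap_mulVec]
  have hker : ∀ i, G.normLap_isHermitian.eigenvalues i = 0 →
      ⇑(G.normLap_isHermitian.eigenvectorBasis i) ⬝ᵥ g = 0 := by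
    intro i hi
    obtain ⟨φ, hφ, hE, -, -⟩ := exists_harmonic hd i
    have hconst : ∀ v, φ v = φ i := fun v => by
      have := hC φ v i
      rw [hE, hi, mul_zero] at this
      exact sub_eq_zero.1 (pow_eq_zero_iff two_ne_zero |>.1 (le_antisymm this (sq_nonneg _)))
    rw [hφ, dotProduct, ← mul_zero (φ i), ← h0, Finset.mul_sum]
    refine Finset.sum_congr rfl fun v _ => ?_
    rw [hconst v, hg]
    linear_combination φ i * f v * hsq v
  obtain ⟨i, hi0, hiR⟩ : ∃ i, G.normLap_isHermitian.eigenvalues i ≠ 0 ∧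
      G.normLap_isHermitian.eigenvalues i ≤ R := by
    by_contra! hcon
    rw [← hNg, ← hgg, G.normLap_isHermitian.dotProduct_mulVec_self_eq_sum,
      ← G.normLap_isHermitian.sum_eigenvectorBasis_dotProduct_mul, Finset.mul_sum] at hR
    rw [← hgg, ← G.normLap_isHermitian.sum_eigenvectorBasis_dotProduct_mul] at hpos
    obtain ⟨i, -, hi⟩ := Finset.exists_ne_zero_of_sum_ne_zero hpos.ne'
    have hi' := mul_self_ne_zero.1 hi
    refine hR.not_gt (Finset.sum_lt_sum (fun j _ => ?_) ⟨i, Finset.mem_univ i, ?_⟩)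
    · by_cases hj : G.normLap_isHermitian.eigenvalues j = 0
      · simp [hker j hj]
      · rw [← sq]
        exact mul_le_mul_of_nonneg_right (hcon j hj).le (sq_nonneg _)
    · rw [← sq]
      exact mul_lt_mul_of_pos_right (hcon i fun h => hi' (hker i h)) (by positivity)
  have hmem : G.normLap_isHermitian.eigenvalues i ∈
      {μ : ℝ | μ ∈ spectrum ℝ G.normLap ∧ μ ≠ 0} :=
    ⟨G.normLap_isHermitian.eigenvalues_mem_spectrum_real i, hi0⟩
  have hlow : ∀ μ ∈ {μ : ℝ | μ ∈ spectrum ℝ G.normLap ∧ μ ≠ 0}, 2 / (C * G.vol) ≤ μ :=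
    fun μ hμ => (two_div_le_of_mem_spectrum hd hC0 hC hμ.1 hμ.2).2
  have hv := (two_div_le_of_mem_spectrum hd hC0 hC hmem.1 hmem.2).1
  have hp : 0 < 2 / (C * G.vol) := by positivity
  unfold kappa
  exact div_le_div_of_nonneg_left zero_le_two (hp.trans_le (le_csInf ⟨_, hmem⟩ hlow))
    ((csInf_le ⟨_, hlow⟩ hmem).trans hiR)

end AdjList

/-! ## Two-lifts of a complete graph with one loop -/

/-- A signature on the complete graph on `B` with a loop at `o`. Among the edges at `o` exactly the
loop is crossed. -/
structure RootedSignature (B : Type*) (o : B) where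
  sign : B → B → Bool
  symm : ∀ a b, sign a b = sign b a
  sign_root : sign o o = true
  sign_root_of_ne : ∀ a, a ≠ o → sign o a = false

/-- The neighbours of `a` in the complete graph on `B` with a loop at `o`. -/
noncomputable def baseList {B : Type*} [Fintype B] [DecidableEq B] (o a : B) : List B :=
  (Finset.univ.filter fun b => b ≠ a ∨ b = o).toList

namespace AdjList

variable {B : Type*} [Fintype B] [DecidableEq B] {o : B} {n : ℕ}

/-- The two-lift of the complete graph on `B` with a loop at `o`: two copies of the complete graph,
where the crossed edges run between the copies. -/
noncomputable def twoLift (e : Bool × B ≃ Fin n) (σ : RootedSignature B o) : AdjList n where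
  nbrs v := (baseList o (e.symm v).2).map fun b =>
    e (xor (e.symm v).1 (σ.sign (e.symm v).2 b), b)
  nodup v := (Finset.nodup_toList _).map fun b b' h => (Prod.ext_iff.1 (e.injective h)).2
  irrefl v := by
    simp only [List.mem_map, baseList, Finset.mem_toList, Finset.mem_filter, Finset.mem_univ,
      true_and, not_exists, not_and]
    intro b hb h
    have h' : (xor (e.symm v).1 (σ.sign (e.symm v).2 b), b) = e.symm v :=
      e.eq_symm_apply.2 h
    generalize e.symm v = w at *
    obtain ⟨x, a⟩ := w
    simp only [Prod.mk.injEq] at h'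
    obtain ⟨h1, rfl⟩ := h'
    -- Only the loop at `o` could lift to a loop, and being crossed it changes the copy.
    obtain rfl : b = o := by simpa using hb
    rw [σ.sign_root] at h1
    cases x <;> simp at h1
  symm u v := by
    obtain ⟨⟨x, a⟩, rfl⟩ := e.surjective u
    obtain ⟨⟨y, b⟩, rfl⟩ := e.surjective v
    simp only [List.mem_map, baseList, Finset.mem_toList, Finset.mem_filter, Finset.mem_univ,
      true_and, e.symm_apply_apply, e.injective.eq_iff, Prod.mk.injEq]
    rintro ⟨c, hc, rfl, rfl⟩
    refine ⟨a, by grind, ?_, rfl⟩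
    rw [σ.symm c a, Bool.xor_assoc, Bool.xor_self, Bool.xor_false]

variable (e : Bool × B ≃ Fin n) (σ τ : RootedSignature B o)

theorem twoLift_adj {x y : Bool} {a b : B} : (twoLift e σ).graph.Adj (e (x, a)) (e (y, b)) ↔
    (b ≠ a ∨ b = o) ∧ y = xor x (σ.sign a b) := by
  simp only [graph, twoLift, List.mem_map, baseList, Finset.mem_toList, Finset.mem_filter,
    Finset.mem_univ, true_and, e.symm_apply_apply, e.injective.eq_iff, Prod.mk.injEq]
  constructor
  · rintro ⟨c, hc, rfl, rfl⟩
    exact ⟨hc, rfl⟩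
  · rintro ⟨h, rfl⟩
    exact ⟨b, h, rfl, rfl⟩

theorem twoLift_adj_hub : (twoLift e σ).graph.Adj (e (false, o)) (e (true, o)) := by
  rw [twoLift_adj, σ.sign_root]
  simp

theorem twoLift_hub_adj {x : Bool} {a : B} (ha : a ≠ o) :
    (twoLift e σ).graph.Adj (e (x, o)) (e (x, a)) := by
  rw [twoLift_adj, σ.sign_root_of_ne a ha]
  simp [ha]

theorem degree_eq_length (G : AdjList n) (v : Fin n) :
    G.graph.degree v = (G.nbrs v).length := by
  rw [← SimpleGraph.card_neighborFinset_eq_degree, ← List.toFinset_card_of_nodup (G.nodup v)]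
  congr 1
  ext u
  rw [List.mem_toFinset, SimpleGraph.mem_neighborFinset]
  rfl

theorem twoLift_degree (x : Bool) (a : B) : (twoLift e σ).graph.degree (e (x, a)) =
    (Finset.univ.filter fun b => b ≠ a ∨ b = o).card := by
  rw [degree_eq_length]
  simp [twoLift, baseList]

theorem twoLift_degree_le (v : Fin n) : (twoLift e σ).graph.degree v ≤ Fintype.card B := by
  obtain ⟨⟨x, a⟩, rfl⟩ := e.surjective v
  rw [twoLift_degree]
  exact Finset.card_le_univ _

theorem le_twoLift_degree (v : Fin n) : Fintype.card B ≤ (twoLift e σ).graph.degree v + 1 := by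
  obtain ⟨⟨x, a⟩, rfl⟩ := e.surjective v
  rw [twoLift_degree, ← Finset.card_univ, ← Finset.card_erase_add_one (Finset.mem_univ a)]
  gcongr
  intro b hb
  simp [Finset.ne_of_mem_erase hb]

theorem twoLift_vol_le : (twoLift e σ).vol ≤ 2 * (Fintype.card B : ℝ) ^ 2 := by
  have hn : (n : ℝ) = 2 * Fintype.card B := by
    have := Fintype.card_congr e
    simp only [Fintype.card_prod, Fintype.card_bool, Fintype.card_fin] at this
    exact_mod_cast this.symm
  calc (twoLift e σ).vol ≤ ∑ _v : Fin n, (Fintype.card B : ℝ) :=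
        Finset.sum_le_sum fun v _ => by exact_mod_cast twoLift_degree_le e σ v
    _ = _ := by
        rw [Finset.sum_const, Finset.card_univ, Fintype.card_fin, nsmul_eq_mul, hn]
        ring

theorem le_twoLift_vol : 2 * (Fintype.card B : ℝ) * (Fintype.card B - 1) ≤ (twoLift e σ).vol := by
  have hn : (n : ℝ) = 2 * Fintype.card B := by
    have := Fintype.card_congr e
    simp only [Fintype.card_prod, Fintype.card_bool, Fintype.card_fin] at this
    exact_mod_cast this.symm
  calc _ = ∑ _v : Fin n, ((Fintype.card B : ℝ) - 1) := by
        rw [Finset.sum_const, Finset.card_univ, Fintype.card_fin, nsmul_eq_mul, hn]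
    _ ≤ _ := Finset.sum_le_sum fun v _ => by
        rw [sub_le_iff_le_add]
        exact_mod_cast le_twoLift_degree e σ v

theorem twoLift_connected : (twoLift e σ).graph.Connected := by
  have : Nonempty (Fin n) := ⟨e (false, o)⟩
  have h : ∀ v, (twoLift e σ).graph.Reachable (e (false, o)) v := by
    intro v
    obtain ⟨⟨x, a⟩, rfl⟩ := e.surjective v
    have hx : (twoLift e σ).graph.Reachable (e (false, o)) (e (x, o)) := by
      cases x
      · rfl
      · exact (twoLift_adj_hub e σ).reachable
    by_cases ha : a = o
    · rwa [ha]
    · exact hx.trans (twoLift_hub_adj e σ ha).reachable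
  exact ⟨fun u v => (h u).symm.trans (h v)⟩

/-- Any two vertices are joined through their hubs by at most three edges, each with squared drop at
most the energy; hence `9 = 3²`. -/
theorem twoLift_sq_sub_le (f : Fin n → ℝ) (u v : Fin n) :
    (f u - f v) ^ 2 ≤ 9 * (twoLift e σ).energy f := by
  have hE := (twoLift e σ).energy_nonneg f
  have hub : ∀ x a, (f (e (x, o)) - f (e (x, a))) ^ 2 ≤ (twoLift e σ).energy f := by
    intro x a
    by_cases ha : a = o
    · simpa [ha] using hE
    · exact (twoLift e σ).sq_sub_le_energy f (twoLift_hub_adj e σ ha)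
  have hst : ∀ x y, (f (e (x, o)) - f (e (y, o))) ^ 2 ≤ (twoLift e σ).energy f := by
    have h := (twoLift e σ).sq_sub_le_energy f (twoLift_adj_hub e σ)
    have h' := (twoLift e σ).sq_sub_le_energy f (twoLift_adj_hub e σ).symm
    intro x y
    cases x <;> cases y <;> first | assumption | simpa using hE
  obtain ⟨⟨x, a⟩, rfl⟩ := e.surjective u
  obtain ⟨⟨y, b⟩, rfl⟩ := e.surjective v
  have h1 := hub x a
  have h2 := hub y b
  have h3 := hst x y
  set p := f (e (x, o)) - f (e (x, a))
  set q := f (e (y, o)) - f (e (y, b))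
  set r := f (e (x, o)) - f (e (y, o))
  have : f (e (x, a)) - f (e (y, b)) = r - p + q := by ring
  rw [this]
  nlinarith [sq_nonneg (p + r), sq_nonneg (p + q), sq_nonneg (r - q)]

theorem twoLift_degree_pos [Nontrivial B] (v : Fin n) : 0 < (twoLift e σ).graph.degree v := by
  have h := le_twoLift_degree e σ v
  have := Fintype.one_lt_card (α := B)
  omega

theorem twoLift_kappa_le [Nontrivial B] : (twoLift e σ).kappa ≤ 18 * (Fintype.card B : ℝ) ^ 2 := by
  have h := kappa_le (twoLift_degree_pos e σ) (by norm_num : (0 : ℝ) < 9) (twoLift_sq_sub_le e σ)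
  have h' := twoLift_vol_le e σ
  linarith

/-- The potential `±1/2` on the two copies of the complete graph. -/
noncomputable def sidePotential (e : Bool × B ≃ Fin n) (v : Fin n) : ℝ :=
  if (e.symm v).1 then -(1 / 2) else 1 / 2

/-- The hub edge is the only edge between the copies, so it alone carries current, namely one unit.
-/
theorem lap_mulVec_sidePotential (hσ : ∀ a b, σ.sign a b = true → a = o ∧ b = o) :
    (twoLift e σ).lap *ᵥ sidePotential e =
      Pi.single (e (false, o)) 1 - Pi.single (e (true, o)) 1 := by
  ext v
  obtain ⟨⟨x, a⟩, rfl⟩ := e.surjective v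
  rw [lap, SimpleGraph.lapMatrix_mulVec_apply, ← SimpleGraph.card_neighborFinset_eq_degree,
    ← nsmul_eq_mul, ← Finset.sum_const, ← Finset.sum_sub_distrib]
  have hzero : ∀ u ∈ (twoLift e σ).graph.neighborFinset (e (x, a)), u ≠ e (!x, o) ∨ a ≠ o →
      sidePotential e (e (x, a)) - sidePotential e u = 0 := by
    intro u hu h
    obtain ⟨⟨y, b⟩, rfl⟩ := e.surjective u
    rw [SimpleGraph.mem_neighborFinset, twoLift_adj] at hu
    have hs : σ.sign a b = false := by
      by_contra hs
      obtain ⟨rfl, rfl⟩ := hσ a b (by simpa using hs)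
      simp only [hu.2, σ.sign_root] at h
      simp at h
    simp [hu.2, hs, sidePotential]
  by_cases ha : a = o
  · subst ha
    rw [Finset.sum_eq_single (e (!x, a)) (fun u hu h => hzero u hu (.inl h))]
    · cases x <;> norm_num [sidePotential, Pi.single_apply]
    · intro h
      refine absurd ?_ h
      rw [SimpleGraph.mem_neighborFinset, twoLift_adj, σ.sign_root]
      simp
  · rw [Finset.sum_eq_zero fun u hu => hzero u hu (.inr ha)]
    simp [ha]

theorem twoLift_resistance (hσ : ∀ a b, σ.sign a b = true → a = o ∧ b = o) :
    (twoLift e σ).resistance (e (false, o)) (e (true, o)) = 1 := by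
  rw [resistance_eq_of_lap_mulVec _ (lap_mulVec_sidePotential e σ hσ)]
  norm_num [sidePotential]

theorem le_twoLift_kappa [Nontrivial B] (hσ : ∀ a b, σ.sign a b = true → a = o ∧ b = o) :
    (Fintype.card B : ℝ) * (Fintype.card B - 1) ≤ (twoLift e σ).kappa := by
  have hvol := le_twoLift_vol e σ
  have hB : (1 : ℝ) < Fintype.card B := by exact_mod_cast Fintype.one_lt_card (α := B)
  have hvpos : 0 < (twoLift e σ).vol := lt_of_lt_of_le (by nlinarith) hvol
  have hE : (twoLift e σ).energy (sidePotential e) = 1 := by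
    rw [← dotProduct_lap_mulVec, lap_mulVec_sidePotential e σ hσ, dotProduct_sub,
      dotProduct_single, dotProduct_single]
    norm_num [sidePotential]
  -- The two lifts of a base vertex have equal degrees and opposite potentials.
  have hsum : ∑ v, ((twoLift e σ).graph.degree v : ℝ) * sidePotential e v = 0 := by
    rw [← e.sum_comp, Fintype.sum_prod_type, Fintype.sum_bool, ← Finset.sum_add_distrib]
    refine Finset.sum_eq_zero fun a _ => ?_
    rw [twoLift_degree, twoLift_degree]
    simp [sidePotential]
  have hsq : ∑ v, ((twoLift e σ).graph.degree v : ℝ) * sidePotential e v ^ 2 =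
      (twoLift e σ).vol / 4 := by
    rw [vol, Finset.sum_div]
    refine Finset.sum_congr rfl fun v _ => ?_
    unfold sidePotential
    split_ifs <;> ring
  have h := le_kappa (twoLift_degree_pos e σ) (by norm_num : (0 : ℝ) < 9) (twoLift_sq_sub_le e σ)
    hsum (by rw [hsq]; positivity) (R := 4 / (twoLift e σ).vol)
    (by rw [hsq, hE]; apply le_of_eq; field_simp)
  have h2 : 2 / (4 / (twoLift e σ).vol) = (twoLift e σ).vol / 2 := by field_simp; ring
  rw [h2] at h
  linarith

theorem twoLift_resistance_le {p q : B} (hp : p ≠ o) (hq : q ≠ o) (hpq : p ≠ q)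
    (h : σ.sign p q = true) :
    (twoLift e σ).resistance (e (false, o)) (e (true, o)) ≤ 3 / 4 := by
  refine resistance_le_of_cycle _ (twoLift_hub_adj e σ hp) (c := e (true, q)) ?_
    (twoLift_hub_adj e σ hq).symm (twoLift_adj_hub e σ).symm ?_ ?_
  · rw [twoLift_adj, h]
    simp [hpq.symm]
  · simp
  · simp

/-- Both lifts follow the order of the same base lists, so a query can only reveal the sign of the
single base edge that it names. -/
theorem twoLift_answer_ne {j : Fin n} {q : Query n}
    (h : (twoLift e σ).answer j q ≠ (twoLift e τ).answer j q) :
    ∃ v i b, q = .neighbor v i ∧ (baseList o (e.symm v).2)[i]? = some b ∧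
      σ.sign (e.symm v).2 b ≠ τ.sign (e.symm v).2 b := by
  cases q with
  | degree v => simp [answer, twoLift] at h
  | jump => simp [answer] at h
  | neighbor v i =>
    simp only [answer, twoLift, List.getElem?_map] at h
    rcases hb : (baseList o (e.symm v).2)[i]? with _ | b
    · simp [hb] at h
    · refine ⟨v, i, b, rfl, hb, fun hs => h ?_⟩
      simp [hb, hs]

end AdjList

/-! ## The hard instances -/

namespace RootedSignature

variable {B : Type*} [DecidableEq B]

/-- The signature in which the loop at `o` and the edge `pq` are crossed. -/
def cross (o p q : B) (h : p = o ↔ q = o) : RootedSignature B o where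
  sign a b := decide (a = o ∧ b = o ∨ a = p ∧ b = q ∨ a = q ∧ b = p)
  symm a b := by grind
  sign_root := by simp
  sign_root_of_ne a ha := by grind

end RootedSignature

/-- There are `c > 0` and `K₀` such that for every `K ≥ K₀` there is an instance `(G, s, t)` with
`c K ≤ κ(G) ≤ K` on which every randomized algorithm makes at least `c K ≥ c κ(G)` queries in
expectation (hence also in the worst case over its coins), provided that on every connected graph
with the same vertices and condition number at most `K` it outputs, with probability at least
`0.6`, a value within `ε ≤ 0.01` of `r(s,t)`. The algorithm may depend on `n, s, t, ε, K`. -/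
theorem theorem7 :
    ∃ c : ℝ, 0 < c ∧ ∃ K₀ : ℝ, ∀ K : ℝ, K₀ ≤ K →
      ∃ (n : ℕ) (_ : NeZero n) (G : AdjList n) (s t : Fin n),
        s ≠ t ∧ G.graph.Connected ∧ c * K ≤ G.kappa ∧ G.kappa ≤ K ∧
        ∀ ε : ℝ, 0 < ε → ε ≤ 0.01 → ∀ A : RandAlg n,
          (∀ H : AdjList n, H.graph.Connected → H.kappa ≤ K →
            ENNReal.ofReal 0.6 ≤ A.successProb H s t ε) →
          ENNReal.ofReal (c * K) ≤ A.expectedQueries G := by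
  -- `162 = 18 · 3²` ensures `k ≥ 1`. Then `K ≤ 18 (2k+3)² ≤ 450 k²`, so `0.2 k² ≥ K / 2250`.
  refine ⟨1 / 2250, by norm_num, 162, fun K hK => ?_⟩
  obtain ⟨k, hk1, hkle, hklt⟩ : ∃ k : ℕ, 1 ≤ k ∧ 18 * (2 * (k : ℝ) + 1) ^ 2 ≤ K ∧
      K ≤ 18 * (2 * (k : ℝ) + 3) ^ 2 := by
    have hS : √(K / 18) ^ 2 = K / 18 := Real.sq_sqrt (by linarith)
    have h3 : 3 ≤ √(K / 18) := Real.le_sqrt_of_sq_le (by linarith)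
    have hf := Nat.floor_le (show 0 ≤ (√(K / 18) - 1) / 2 by linarith)
    have hl := Nat.lt_floor_add_one ((√(K / 18) - 1) / 2)
    refine ⟨⌊(√(K / 18) - 1) / 2⌋₊, Nat.one_le_floor_iff _ |>.2 (by linarith), ?_, ?_⟩ <;>
      nlinarith
  let B := Option (Fin k ⊕ Fin k)
  have hcard : (Fintype.card B : ℝ) = 2 * k + 1 := by
    simp only [B, Fintype.card_option, Fintype.card_sum, Fintype.card_fin]
    push_cast
    ring
  have : Nontrivial B := ⟨none, some (.inl ⟨0, hk1⟩), by simp⟩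
  let e : Bool × B ≃ Fin (Fintype.card (Bool × B)) := Fintype.equivFin _
  -- With `p = q = o` the extra crossed edge is the loop itself.
  let σ : RootedSignature B none := .cross none none none Iff.rfl
  -- Taking `p` and `q` from different halves makes the `k²` pairs give distinct unordered edges.
  let τ : Fin k × Fin k → RootedSignature B none := fun i =>
    .cross none (some (.inl i.1)) (some (.inr i.2)) (by simp)
  have hσ : ∀ a b, σ.sign a b = true → a = none ∧ b = none := by
    intro a b h
    simpa [σ, RootedSignature.cross] using h
  have hτ : ∀ i a b, (τ i).sign a b ≠ σ.sign a b →
      (a = some (.inl i.1) ∧ b = some (.inr i.2)) ∨ (a = some (.inr i.2) ∧ b = some (.inl i.1)) := by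
    intro i a b h
    contrapose! h
    simp only [τ, σ, RootedSignature.cross, decide_eq_decide]
    grind
  have hκ : ∀ ρ : RootedSignature B none, (AdjList.twoLift e ρ).kappa ≤ K := fun ρ =>
    (AdjList.twoLift_kappa_le e ρ).trans (by rw [hcard]; exact hkle)
  have hk : (1 : ℝ) ≤ k := by exact_mod_cast hk1
  refine ⟨_, ⟨Fintype.card_ne_zero⟩, AdjList.twoLift e σ, e (false, none), e (true, none), by simp,
    AdjList.twoLift_connected e σ, ?_, hκ σ, fun ε hε hε' A hA => ?_⟩
  · refine le_trans ?_ (AdjList.le_twoLift_kappa e σ hσ)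
    rw [hcard]
    nlinarith
  · have : NeZero (Fintype.card (Bool × B)) := ⟨Fintype.card_ne_zero⟩
    refine le_trans (ENNReal.ofReal_le_ofReal ?_)
      (A.expectedQueries_ge (AdjList.twoLift e σ) (fun i => AdjList.twoLift e (τ i))
        (e (false, none)) (e (true, none)) ε ?_ ?_
        (hA _ (AdjList.twoLift_connected e σ) (hκ σ))
        fun i => hA _ (AdjList.twoLift_connected e (τ i)) (hκ (τ i)))
    · simp only [Fintype.card_prod, Fintype.card_fin]
      push_cast
      nlinarith
    · intro q i i' j h h'
      obtain ⟨v, l, b, rfl, hb, hs⟩ := AdjList.twoLift_answer_ne e (τ i) σ h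
      obtain ⟨v', l', b', hq, hb', hs'⟩ := AdjList.twoLift_answer_ne e (τ i') σ h'
      simp only [Query.neighbor.injEq] at hq
      obtain ⟨rfl, rfl⟩ := hq
      obtain rfl : b = b' := by simpa [hb] using hb'
      have h1 := hτ i _ _ hs
      have h2 := hτ i' _ _ hs'
      ext <;> grind
    · intro i
      have h1 := AdjList.twoLift_resistance e σ hσ
      have h2 := AdjList.twoLift_resistance_le e (τ i) (p := some (.inl i.1))
        (q := some (.inr i.2)) (by simp) (by simp)
        ((Option.some_injective _).ne Sum.inl_ne_inr) (by simp [τ, RootedSignature.cross])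
      rw [h1]
      -- The gap is at least `1 - 3/4 = 1/4`, more than `2 · 0.01`.
      refine lt_of_lt_of_le ?_ (le_abs_self _)
      norm_num at hε'
      linarith
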